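/- Let $K$ be a field, let $n \ge 2$, and let $R = K[x_{ij} : 1 \le i \le j \le n]$. Let $G$ be a simple graph with vertex set $[n] = \{1,\dots,n\}$. Let $X_G$ be the symmetric $n\times n$ matrix over $R$ whose $(i,j)$ entry is $x_{ii}$ if $i=j$, is $x_{\min(i,j),\max(i,j)}$ if $ij$ is an edge of $G$, and is $0$ otherwise. For $1 \le k \le n$ let $I_k(X_G) \subseteq R$ be the ideal generated by all $k$-minors (determinants of $k\times k$ submatrices) of $X_G$, and call $G$ $(n-k+1)$-connected if for every $M \subseteq [n]$ with $|M| = k$ the subgraph of $G$ induced on $M$ is connected. (1) The ideal $I_n(X_G) = (\det(X_G))$ is prime if and only if $G$ is connected; equally, $\det(X_G)$ is an irreducible polynomial if and only if $G$ is connected. (2) If $\operatorname{char}(K) = 0$, then for $k \in \{2,3\}$ with $k \le n$, the ideal $I_k(X_G)$ is prime if and only if $G$ is $(n-k+1)$-connected. -/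

import Mathlib

namespace SparseSymmetric

/-- The polynomial ring `K[x_{ij} : 1 ≤ i ≤ j ≤ n]`. The variable `x_{ij} = x_{ji}` is indexed by
the unordered pair `s(i, j)`, where `i = j` is allowed. -/
abbrev PolyRing (K : Type*) [Field K] (n : ℕ) : Type _ := MvPolynomial (Sym2 (Fin n)) K

/-- The generic symmetric `n × n` matrix `X = (x_{ij})`. -/
noncomputable def genericSymm (K : Type*) [Field K] (n : ℕ) :
    Matrix (Fin n) (Fin n) (PolyRing K n) :=
  Matrix.of fun i j => MvPolynomial.X s(i, j)

open Classical in
/-- The sparse generic symmetric matrix `X_G`: the matrix `X` with zeros substituted for the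
off-diagonal variables that correspond to the non-edges of `G`. -/
noncomputable def sparseSymm (K : Type*) [Field K] {n : ℕ} (G : SimpleGraph (Fin n)) :
    Matrix (Fin n) (Fin n) (PolyRing K n) :=
  Matrix.of fun i j => if i = j ∨ G.Adj i j then genericSymm K n i j else 0

/-- The ideal `I_k(A)` generated by all `k`-minors of the square matrix `A`, i.e. by the
determinants of the submatrices given by `k` rows and `k` columns. -/
def minorIdeal {R : Type*} [CommRing R] {n : ℕ} (k : ℕ) (A : Matrix (Fin n) (Fin n) R) : Ideal R :=
  Ideal.span {f : R | ∃ r c : Fin k ↪o Fin n, f = (A.submatrix r c).det}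

/-- A graph on `n` vertices is `c`-connected if all its induced subgraphs on `n - c + 1` vertices
are connected. Thus `(n - k + 1)`-connected means that the induced subgraph on every set of exactly
`k` vertices is connected. -/
def IsVertexConnected {n : ℕ} (c : ℕ) (G : SimpleGraph (Fin n)) : Prop :=
  ∀ M : Finset (Fin n), M.card + c = n + 1 → (G.induce (M : Set (Fin n))).Connected

end SparseSymmetric

/-! ### Ring extensions in which symmetric matrices of rank one and two factor -/

namespace SparseSymmetric

/-! Necessity, for every `k`: if `G` is disconnected on a `k`-set, the principal minor on that set
is a product of two smaller principal minors. Neither factor lies in the ideal, since each becomes 1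
at a 0/1 diagonal matrix of rank less than `k` (`det_block_notMem_minorIdeal`).

Irreducibility of the determinant: grow a vertex set along edges of `G`. Each new vertex `v` makes
the determinant linear in `x_vv`, with the previous irreducible determinant as leading coefficient;
an edge into `v` shows that this coefficient does not divide the constant term
(`irreducible_det_insert`).

Sufficiency for `k = 2, 3`: the ideal is shown to be the kernel of a map into a domain. For `k = 2`
the graph is complete and the map is the toric parametrization of symmetric rank-one matrices. For
`k = 3` the non-edges form a matching. Over the quotient by the ideal, the matrix `p` of residue
classes becomes `μ + μᵀ` with `μ` of rank one, after an injective ring extension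
(`exists_ring_of_rank_two`; this needs 1/2). Up to signs `μ` is symmetric on each non-edge, and
products of entries of such a matrix depend only on certain margins (`prod_eq_of_margins`). Hence
any relation killed by the toric map that records these margins already holds for `μ`
(`map_eq_zero_of_margin_map`), so it lies in the ideal. -/

/-- The commutative ring `A ⊕ M` in which the product of two elements of `M` is given by an
`A`-valued symmetric bilinear form of rank one. -/
@[reducible]
def evenOddRing {A M : Type*} [CommRing A] [AddCommGroup M] [Module A M]
    (B : M →ₗ[A] M →ₗ[A] A) (hs : ∀ x y, B x y = B y x)
    (ha : ∀ x y z, B x y • z = B y z • x) : CommRing (A × M) :=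
  { (inferInstance : AddCommGroup (A × M)) with
    mul := fun x y => (x.1 * y.1 + B x.2 y.2, x.1 • y.2 + y.1 • x.2)
    one := (1, 0)
    left_distrib := by
      intro x y z
      refine Prod.ext ?_ ?_
      · change x.1 * (y.1 + z.1) + B x.2 (y.2 + z.2)
          = (x.1 * y.1 + B x.2 y.2) + (x.1 * z.1 + B x.2 z.2)
        rw [map_add]; ring
      · change x.1 • (y.2 + z.2) + (y.1 + z.1) • x.2
          = (x.1 • y.2 + y.1 • x.2) + (x.1 • z.2 + z.1 • x.2)
        module
    right_distrib := by
      intro x y z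
      refine Prod.ext ?_ ?_
      · change (x.1 + y.1) * z.1 + B (x.2 + y.2) z.2
          = (x.1 * z.1 + B x.2 z.2) + (y.1 * z.1 + B y.2 z.2)
        rw [map_add, LinearMap.add_apply]; ring
      · change (x.1 + y.1) • z.2 + z.1 • (x.2 + y.2)
          = (x.1 • z.2 + z.1 • x.2) + (y.1 • z.2 + z.1 • y.2)
        module
    zero_mul := by
      intro x
      refine Prod.ext ?_ ?_
      · change 0 * x.1 + B 0 x.2 = 0
        simp
      · change (0 : A) • x.2 + x.1 • (0 : M) = 0
        simp
    mul_zero := by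
      intro x
      refine Prod.ext ?_ ?_
      · change x.1 * 0 + B x.2 0 = 0
        simp
      · change x.1 • (0 : M) + (0 : A) • x.2 = 0
        simp
    mul_assoc := by
      intro x y z
      refine Prod.ext ?_ ?_
      · change (x.1 * y.1 + B x.2 y.2) * z.1 + B (x.1 • y.2 + y.1 • x.2) z.2
          = x.1 * (y.1 * z.1 + B y.2 z.2) + B x.2 (y.1 • z.2 + z.1 • y.2)
        simp only [map_add, map_smul, LinearMap.add_apply, LinearMap.smul_apply, smul_eq_mul]
        ring
      · change (x.1 * y.1 + B x.2 y.2) • z.2 + z.1 • (x.1 • y.2 + y.1 • x.2)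
          = x.1 • (y.1 • z.2 + z.1 • y.2) + (y.1 * z.1 + B y.2 z.2) • x.2
        rw [add_smul, add_smul, ha]
        module
    one_mul := by
      intro x
      refine Prod.ext ?_ ?_
      · change 1 * x.1 + B 0 x.2 = x.1
        simp
      · change (1 : A) • x.2 + x.1 • (0 : M) = x.2
        simp
    mul_one := by
      intro x
      refine Prod.ext ?_ ?_
      · change x.1 * 1 + B x.2 0 = x.1
        simp
      · change x.1 • (0 : M) + (1 : A) • x.2 = x.2
        simp
    mul_comm := by
      intro x y
      refine Prod.ext ?_ ?_
      · change x.1 * y.1 + B x.2 y.2 = y.1 * x.1 + B y.2 x.2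
        rw [hs, mul_comm]
      · change x.1 • y.2 + y.1 • x.2 = y.1 • x.2 + x.1 • y.2
        rw [add_comm] }

/-- A symmetric rank-one matrix `b` over `A` can be written as `b e f = m e * m f` in an extension
ring of `A`, such that all linear relations between the rows of `b` hold for the `m e`. -/
theorem exists_ring_of_rank_one.{u, v} {A : Type u} {E : Type v} [CommRing A] (b : E → E → A)
    (hs : ∀ e f, b e f = b f e) (hb : ∀ e f g h, b e f * b g h = b f g * b e h) :
    ∃ (T : Type (max u v)) (_ : CommRing T) (inc : A →+* T) (m : E → T),
      Function.Injective inc ∧ (∀ e f, m e * m f = inc (b e f)) ∧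
      ∀ (k : ℕ) (s : Fin k → E) (c : Fin k → A), (∀ f, ∑ i, c i * b (s i) f = 0) →
        ∑ i, inc (c i) * m (s i) = 0 := by
  let B₀ : (E →₀ A) →ₗ[A] (E →₀ A) →ₗ[A] A :=
    Finsupp.linearCombination A fun e => Finsupp.linearCombination A fun f => b e f
  have hB₀ : ∀ e f x y, B₀ (Finsupp.single e x) (Finsupp.single f y) = x * (y * b e f) := by
    intro e f x y
    simp [B₀, Finsupp.linearCombination_single]
  have hs₀ : ∀ x y, B₀ x y = B₀ y x := by
    intro x y
    have : B₀ = B₀.flip := by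
      ext e f
      simp [hB₀, hs e f]
    exact LinearMap.congr_fun₂ this x y
  -- Associativity in `A ⊕ M` requires this difference to vanish, but rank one only puts it in the
  -- radical of the form. Dividing by the radical repairs this, and also turns relations between
  -- rows of `b` into relations between the generators.
  have ha₀ : ∀ x y z, B₀ x y • z - B₀ y z • x ∈ LinearMap.ker B₀ := by
    intro x y z
    induction x using Finsupp.induction_linear with
    | zero => simp
    | add x x' hx hx' =>
      have := add_mem hx hx'
      convert this using 1
      simp only [map_add, LinearMap.add_apply]
      module
    | single e a =>
    induction y using Finsupp.induction_linear with
    | zero => simp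
    | add x x' hx hx' =>
      have := add_mem hx hx'
      convert this using 1
      simp only [map_add, LinearMap.add_apply]
      module
    | single f a' =>
    induction z using Finsupp.induction_linear with
    | zero => simp
    | add x x' hx hx' =>
      have := add_mem hx hx'
      convert this using 1
      simp only [map_add]
      module
    | single g a'' =>
    rw [LinearMap.mem_ker]
    ext h
    simp only [map_sub, map_smul, LinearMap.comp_apply, LinearMap.sub_apply, LinearMap.smul_apply,
      hB₀, Finsupp.lsingle_apply, smul_eq_mul, LinearMap.zero_apply]
    linear_combination (a * a' * a'') * hb e f g h
  let M := (E →₀ A) ⧸ LinearMap.ker B₀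
  let B₁ : M →ₗ[A] (E →₀ A) →ₗ[A] A := (LinearMap.ker B₀).liftQ B₀ le_rfl
  let B : M →ₗ[A] M →ₗ[A] A := ((LinearMap.ker B₀).liftQ B₁.flip (by
    intro x hx
    rw [LinearMap.mem_ker] at hx ⊢
    ext e
    simp only [LinearMap.comp_apply]
    change B₀ _ x = 0
    rw [hs₀, hx]; rfl)).flip
  have hB : ∀ x y, B (Submodule.Quotient.mk x) (Submodule.Quotient.mk y) = B₀ x y := fun _ _ => rfl
  have hsB : ∀ x y, B x y = B y x := by
    intro x y
    obtain ⟨x, rfl⟩ := Submodule.Quotient.mk_surjective _ x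
    obtain ⟨y, rfl⟩ := Submodule.Quotient.mk_surjective _ y
    rw [hB, hB, hs₀]
  have haB : ∀ x y z, B x y • z = B y z • x := by
    intro x y z
    obtain ⟨x, rfl⟩ := Submodule.Quotient.mk_surjective _ x
    obtain ⟨y, rfl⟩ := Submodule.Quotient.mk_surjective _ y
    obtain ⟨z, rfl⟩ := Submodule.Quotient.mk_surjective _ z
    rw [hB, hB, ← Submodule.Quotient.mk_smul, ← Submodule.Quotient.mk_smul,
      Submodule.Quotient.eq]
    exact ha₀ x y z
  let R : CommRing (A × M) := evenOddRing B hsB haB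
  let inc : A →+* A × M :=
    { toFun := fun a => (a, 0)
      map_one' := rfl
      map_zero' := rfl
      map_add' := by
        intro x y
        refine Prod.ext rfl ?_
        change (0 : M) = 0 + 0
        simp
      map_mul' := by
        intro x y
        refine Prod.ext ?_ ?_
        · change x * y = x * y + B 0 0
          simp
        · change (0 : M) = x • (0 : M) + y • (0 : M)
          simp }
  refine ⟨A × M, R, inc, fun e => (0, Submodule.Quotient.mk (Finsupp.single e 1)), ?_, ?_, ?_⟩
  · intro x y h
    exact congrArg Prod.fst h
  · intro e f
    refine Prod.ext ?_ ?_
    · change 0 * 0 + B _ _ = b e f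
      rw [hB, hB₀]; simp
    · change (0 : A) • _ + (0 : A) • _ = (0 : M)
      simp
  · intro k s c h
    have h1 : ∀ i, inc (c i) * ((0, Submodule.Quotient.mk (Finsupp.single (s i) 1)) : A × M)
        = (0, Submodule.Quotient.mk (Finsupp.single (s i) (c i))) := by
      intro i
      refine Prod.ext ?_ ?_
      · change c i * 0 + B 0 _ = 0
        simp
      · change c i • Submodule.Quotient.mk _ + (0 : A) • _ = _
        rw [← Submodule.Quotient.mk_smul]
        simp
    rw [Finset.sum_congr rfl fun i _ => h1 i]
    have h2 : ∀ t : Finset (Fin k),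
        ∑ i ∈ t, ((0, Submodule.Quotient.mk (Finsupp.single (s i) (c i))) : A × M)
          = (0, Submodule.Quotient.mk (∑ i ∈ t, Finsupp.single (s i) (c i))) := by
      classical
      intro t
      induction t using Finset.induction_on with
      | empty => rfl
      | insert i t hi ih =>
        rw [Finset.sum_insert hi, Finset.sum_insert hi, ih]
        refine Prod.ext ?_ rfl
        change (0 : A) + 0 = 0
        simp
    rw [h2]
    refine Prod.ext rfl ?_
    change Submodule.Quotient.mk _ = (0 : M)
    rw [Submodule.Quotient.mk_eq_zero, LinearMap.mem_ker]
    ext f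
    simp only [map_sum, LinearMap.comp_apply, LinearMap.sum_apply, Finsupp.lsingle_apply, hB₀,
      LinearMap.zero_apply, one_mul]
    exact h f

/-- A symmetric matrix `p` of rank at most two becomes `μ + μᵀ` with `μ` of rank at most one after
an extension of rings. -/
theorem exists_ring_of_rank_two.{u, v} {A : Type u} {ι : Type v} [CommRing A] (half : A)
    (hhalf : 2 * half = 1) (p : ι → ι → A) (hs : ∀ i j, p i j = p j i)
    (h3 : ∀ i w x j k l, p i j * (p w k * p x l - p w l * p x k)
      - p i k * (p w j * p x l - p w l * p x j) + p i l * (p w j * p x k - p w k * p x j) = 0) :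
    ∃ (T : Type (max u v)) (_ : CommRing T) (inc : A →+* T) (μ : ι → ι → T),
      Function.Injective inc ∧ (∀ i j, μ i j + μ j i = inc (p i j)) ∧
      (∀ i j k l, μ i j * μ k l = μ i l * μ k j) := by
  -- Model case: if `p i j = α i * β j + β i * α j`, then `m (i, j) = α i * β j - α j * β i`
  -- satisfies `m e * m f = b e f`, and `(p + m) / 2` is the rank-one matrix `α i * β j`. So `m`
  -- plays the role of a square root of the discriminant.
  let b : ι × ι → ι × ι → A := fun e f => p e.1 f.2 * p e.2 f.1 - p e.1 f.1 * p e.2 f.2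
  obtain ⟨T, _, inc, m, hinj, hm, hrel⟩ := exists_ring_of_rank_one b
    (by
      rintro ⟨i, j⟩ ⟨k, l⟩
      simp only [b, hs k j, hs k i, hs l i, hs l j]
      ring)
    (by
      rintro ⟨i, j⟩ ⟨k, l⟩ ⟨u, v⟩ ⟨w, x⟩
      simp only [b]
      -- The 2-minors of a matrix of rank at most two form a matrix of rank at most one; four
      -- 3-minors of `p` witness this.
      have e1 := h3 k w x i u v
      have e2 := h3 k w x j u v
      have e3 := h3 l w x j i v
      have e4 := h3 l w x j i u
      simp only [hs w, hs x] at e1 e2 e3 e4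
      rw [hs i k, hs i l, hs j k, hs j l]
      linear_combination p l j * e1 - p l i * e2 + p k u * e3 - p k v * e4)
  have halt : ∀ i j, m (i, j) + m (j, i) = 0 := by
    intro i j
    have := hrel 2 ![(i, j), (j, i)] ![1, 1] (by
      rintro ⟨w, x⟩
      simp only [Fin.sum_univ_two, b, Matrix.cons_val_zero, Matrix.cons_val_one]
      ring)
    simpa [Fin.sum_univ_two] using this
  have hcyc : ∀ i j k l, inc (p i j) * m (k, l) + inc (p i k) * m (l, j)
      + inc (p i l) * m (j, k) = 0 := by
    intro i j k l
    have := hrel 3 ![(k, l), (l, j), (j, k)] ![p i j, p i k, p i l] (by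
      rintro ⟨w, x⟩
      have e1 := h3 i w x j k l
      simp only [hs w, hs x] at e1
      simp [Fin.sum_univ_three, b]
      linear_combination (-1) * e1)
    simpa [Fin.sum_univ_three] using this
  refine ⟨T, inferInstance, inc, fun i j => inc half * (inc (p i j) + m (i, j)), hinj, ?_, ?_⟩
  · intro i j
    have h2 : 2 * inc half = 1 := by rw [← map_one inc, ← hhalf, map_mul, map_ofNat]
    beta_reduce
    rw [hs j i]
    linear_combination inc half * halt i j + inc (p i j) * h2
  · intro i j k l
    have e1 := hm (i, j) (k, l)
    have e2 := hm (i, l) (k, j)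
    simp only [b, map_sub, map_mul] at e1 e2
    rw [hs l k, hs l j] at e2
    rw [hs j k] at e1
    beta_reduce
    have c1 := hcyc i j k l
    have c2 := hcyc k l i j
    rw [hs k i] at c2
    have a1 := halt j l
    have a2 := halt j k
    have a3 := halt l i
    linear_combination (inc half) ^ 2 * (e1 - e2 + c1 + c2 - inc (p i k) * a1
      - inc (p i l) * a2 - inc (p k j) * a3)

end SparseSymmetric

/-! ### Margins of multisets of pairs and kernels of toric maps -/

namespace SparseSymmetric

section Margins

variable {ι κ T : Type*} [CommMonoid T]

/-- Two multisets of pairs have the same margins (up to `c`) and the same product under `μ`. -/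
structure SameMargins (c : ι → κ) (μ : ι → ι → T) (w v : Multiset (ι × ι)) : Prop where
  row : w.map (fun e => c e.1) = v.map (fun e => c e.1)
  col : w.map (fun e => c e.2) = v.map (fun e => c e.2)
  tot : w.map Prod.fst + w.map Prod.snd = v.map Prod.fst + v.map Prod.snd
  prod : (w.map fun e => μ e.1 e.2).prod = (v.map fun e => μ e.1 e.2).prod

variable {c : ι → κ} {μ : ι → ι → T}

theorem SameMargins.refl (w : Multiset (ι × ι)) : SameMargins c μ w w := ⟨rfl, rfl, rfl, rfl⟩

theorem SameMargins.trans {u v w : Multiset (ι × ι)} (h : SameMargins c μ u v)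
    (h' : SameMargins c μ v w) : SameMargins c μ u w :=
  ⟨h.row.trans h'.row, h.col.trans h'.col, h.tot.trans h'.tot, h.prod.trans h'.prod⟩

theorem sameMargins_swap (h1 : ∀ i j k l, μ i j * μ k l = μ i l * μ k j) (i j k l : ι)
    (v : Multiset (ι × ι)) :
    SameMargins c μ ((i, j) ::ₘ (k, l) ::ₘ v) ((i, l) ::ₘ (k, j) ::ₘ v) where
  row := by simp
  col := by simp [Multiset.cons_swap]
  tot := by simp [Multiset.cons_swap]
  prod := by simp [← mul_assoc, h1 i j k l]

theorem sameMargins_flip (h2 : ∀ i j, c i = c j → μ i j = μ j i) {i j : ι} (hij : c i = c j)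
    (v : Multiset (ι × ι)) :
    SameMargins c μ ((i, j) ::ₘ v) ((j, i) ::ₘ v) where
  row := by simp [hij]
  col := by simp [hij]
  tot := by simp [Multiset.cons_swap]
  prod := by simp [h2 i j hij]

/-- One swap pairs any available row index with any available column index. The row and column
multisets themselves are preserved, not only their classes; this is needed to keep track of an index
through a later flip. -/
theorem exists_sameMargins_cons (h1 : ∀ i j k l, μ i j * μ k l = μ i l * μ k j) {i l : ι}
    {w : Multiset (ι × ι)} (hi : i ∈ w.map Prod.fst) (hl : l ∈ w.map Prod.snd) :
    ∃ v, SameMargins c μ w ((i, l) ::ₘ v) ∧ w.map Prod.fst = ((i, l) ::ₘ v).map Prod.fst ∧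
      w.map Prod.snd = ((i, l) ::ₘ v).map Prod.snd := by
  obtain ⟨⟨i, j⟩, hw, rfl⟩ := Multiset.mem_map.1 hi
  obtain ⟨⟨k, l⟩, hw', rfl⟩ := Multiset.mem_map.1 hl
  obtain ⟨v, rfl⟩ := Multiset.exists_cons_of_mem hw
  rcases Multiset.mem_cons.1 hw' with h | h
  · obtain ⟨rfl, rfl⟩ := Prod.mk.inj h
    exact ⟨v, SameMargins.refl _, rfl, rfl⟩
  · obtain ⟨v, rfl⟩ := Multiset.exists_cons_of_mem h
    refine ⟨(k, j) ::ₘ v, sameMargins_swap h1 _ _ _ _ _, by simp, ?_⟩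
    simp [Multiset.cons_swap]

/-- If `k` occurs only as a column, swap it next to a row index of its own class and flip that pair.
-/
theorem exists_sameMargins_mem_fst (h1 : ∀ i j k l, μ i j * μ k l = μ i l * μ k j)
    (h2 : ∀ i j, c i = c j → μ i j = μ j i) {k : ι} {w : Multiset (ι × ι)}
    (hk : c k ∈ w.map fun e => c e.1) (hk' : k ∈ w.map Prod.fst + w.map Prod.snd) :
    ∃ v, SameMargins c μ w v ∧ k ∈ v.map Prod.fst := by
  rcases Multiset.mem_add.1 hk' with h | h
  · exact ⟨w, SameMargins.refl _, h⟩
  · obtain ⟨e, he, hce⟩ := Multiset.mem_map.1 hk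
    obtain ⟨v, hv, -, -⟩ := exists_sameMargins_cons (c := c) h1 (Multiset.mem_map_of_mem _ he) h
    exact ⟨_, hv.trans (sameMargins_flip h2 hce v), by simp⟩

-- The same swap and flip brings `l` into a column, at the cost of one occurrence of `l` as a row.
-- When `l = k`, the multiplicity hypothesis leaves another occurrence of `k` among the rows.
open Classical in
theorem exists_sameMargins_mem_snd (h1 : ∀ i j k l, μ i j * μ k l = μ i l * μ k j)
    (h2 : ∀ i j, c i = c j → μ i j = μ j i) {k l : ι} {w : Multiset (ι × ι)}
    (hk : k ∈ w.map Prod.fst)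
    (hl : c l ∈ w.map fun e => c e.2) (hl' : l ∈ w.map Prod.fst + w.map Prod.snd)
    (hkl : l = k → 2 ≤ (w.map Prod.fst + w.map Prod.snd).count k) :
    ∃ v, SameMargins c μ w v ∧ k ∈ v.map Prod.fst ∧ l ∈ v.map Prod.snd := by
  by_cases h : l ∈ w.map Prod.snd
  · exact ⟨w, SameMargins.refl _, hk, h⟩
  have h' : l ∈ w.map Prod.fst := (Multiset.mem_add.1 hl').resolve_right h
  obtain ⟨e, he, hce⟩ := Multiset.mem_map.1 hl
  obtain ⟨v, hv, hf, hs⟩ := exists_sameMargins_cons (c := c) h1 h' (Multiset.mem_map_of_mem _ he)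
  refine ⟨_, hv.trans (sameMargins_flip h2 hce.symm v), ?_, by simp⟩
  rw [Multiset.map_cons] at hf ⊢
  refine Multiset.mem_cons_of_mem ?_
  by_cases e1 : l = k
  · subst e1
    have := hkl rfl
    rw [Multiset.count_add, Multiset.count_eq_zero_of_notMem h, hf, Multiset.count_cons_self] at this
    exact Multiset.count_pos.1 (by omega)
  · rw [hf] at hk
    exact (Multiset.mem_cons.1 hk).resolve_left fun h => e1 h.symm

/-- If `μ` has rank one and is symmetric within the fibres of `c`, then a product of entries of `μ`
depends only on the row and column classes and on the total vertex content. -/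
theorem prod_eq_of_margins (h1 : ∀ i j k l, μ i j * μ k l = μ i l * μ k j)
    (h2 : ∀ i j, c i = c j → μ i j = μ j i) (w' : Multiset (ι × ι)) :
    ∀ w : Multiset (ι × ι), w.map (fun e => c e.1) = w'.map (fun e => c e.1) →
      w.map (fun e => c e.2) = w'.map (fun e => c e.2) →
      w.map Prod.fst + w.map Prod.snd = w'.map Prod.fst + w'.map Prod.snd →
      (w.map fun e => μ e.1 e.2).prod = (w'.map fun e => μ e.1 e.2).prod := by
  classical
  induction w' using Multiset.induction_on with
  | empty =>
    intro w hr _ _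
    have : w = 0 := by simpa using hr
    rw [this]
  | cons a w' ih =>
    obtain ⟨k, l⟩ := a
    intro w hr hc ht
    -- Swaps and flips create the pair `(k, l)` inside `w`; it then cancels against the same pair of
    -- the other multiset.
    obtain ⟨v, hv, hkv⟩ := exists_sameMargins_mem_fst (k := k) (w := w) h1 h2 (by simp [hr])
      (by simp [ht])
    obtain ⟨v', hv', hkv', hlv'⟩ := exists_sameMargins_mem_snd (l := l) h1 h2 hkv
      (by rw [← hv.col, hc]; simp) (by rw [← hv.tot, ht]; simp)
      (by
        rintro rfl
        rw [← hv.tot, ht, Multiset.map_cons, Multiset.map_cons, Multiset.count_add,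
          Multiset.count_cons_self, Multiset.count_cons_self]
        omega)
    obtain ⟨u, hu, -, -⟩ := exists_sameMargins_cons (c := c) h1 hkv' hlv'
    have hw := (hv.trans hv').trans hu
    rw [hw.prod, Multiset.map_cons, Multiset.map_cons, Multiset.prod_cons, Multiset.prod_cons]
    congr 1
    refine ih u ?_ ?_ ?_
    · have := hw.row.symm.trans hr
      simpa using this
    · have := hw.col.symm.trans hc
      simpa using this
    · have := hw.tot.symm.trans ht
      simpa [Multiset.cons_swap] using this

end Margins

open MvPolynomial

/-- The kernel of a monomial map is contained in the kernel of every ring map which identifies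
monomials with the same image. -/
theorem map_eq_zero_of_monomial_map {R σ τ T : Type*} [CommRing R] [CommRing T]
    (u : σ → τ →₀ ℕ) (Θ : MvPolynomial σ R →+* T)
    (hΘ : ∀ w w' : σ →₀ ℕ, (w.sum fun s k => k • u s) = (w'.sum fun s k => k • u s) →
      Θ (monomial w 1) = Θ (monomial w' 1))
    (f : MvPolynomial σ R)
    (hf : aeval (fun s => (monomial (u s) 1 : MvPolynomial τ R)) f = 0) : Θ f = 0 := by
  classical
  let im : (σ →₀ ℕ) → τ →₀ ℕ := fun w => w.sum fun s k => k • u s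
  -- `Θ` factors through the monomial map as an `R`-linear map, defined on monomials by `g`. The
  -- value 0 off the image is arbitrary.
  let g : (τ →₀ ℕ) → T := fun d => if h : ∃ w, im w = d then Θ (monomial h.choose 1) else 0
  have hg : ∀ w, g (im w) = Θ (monomial w 1) := by
    intro w
    have h : ∃ w', im w' = im w := ⟨w, rfl⟩
    simp only [g, dif_pos h]
    exact hΘ _ _ h.choose_spec
  let _ : Module R T := Module.compHom T (Θ.comp C)
  let L : MvPolynomial τ R →ₗ[R] T := (basisMonomials τ R).constr R g
  have hL : ∀ d a, L (monomial d a) = Θ (C a) * g d := by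
    intro d a
    have h1 : (monomial d a : MvPolynomial τ R) = a • basisMonomials τ R d := by
      rw [coe_basisMonomials, smul_monomial, smul_eq_mul, mul_one]
    rw [h1, map_smul, Module.Basis.constr_basis]
    rfl
  have key : ∀ p : MvPolynomial σ R,
      L (aeval (fun s => (monomial (u s) 1 : MvPolynomial τ R)) p) = Θ p := by
    intro p
    induction p using MvPolynomial.induction_on' with
    | add p q hp hq => rw [map_add, map_add, map_add, hp, hq]
    | monomial w a =>
      have h1 : (w.prod fun s k => (monomial (u s) (1 : R)) ^ k) = monomial (im w) 1 := by
        simp only [im, monomial_pow, one_pow]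
        rw [Finsupp.sum, Finsupp.prod, monomial_sum_one]
      rw [aeval_monomial, h1, algebraMap_eq, C_mul_monomial, mul_one, hL, hg, ← map_mul,
        C_mul_monomial, mul_one]
  rw [← key, hf, map_zero]

theorem eq_of_map_inl_add_map_inr {α β : Type*} {s s' : Multiset α} {t t' : Multiset β}
    (h : s.map Sum.inl + t.map Sum.inr = s'.map Sum.inl + t'.map Sum.inr) : s = s' ∧ t = t' := by
  classical
  constructor
  · ext a
    have := congrArg (Multiset.count (Sum.inl a)) h
    simpa [Multiset.count_map_eq_count' _ _ Sum.inl_injective] using this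
  · ext a
    have := congrArg (Multiset.count (Sum.inr a)) h
    simpa [Multiset.count_map_eq_count' _ _ Sum.inr_injective] using this

/-- The kernel of the Segre-type map `z_{ij} ↦ s_{c(i)} r_{c(j)} u_i u_j`. -/
theorem map_eq_zero_of_margin_map {R ι κ T : Type*} [CommRing R] [CommRing T] (c : ι → κ)
    (Θ : MvPolynomial (ι × ι) R →+* T)
    (h1 : ∀ i j k l, Θ (X (i, j)) * Θ (X (k, l)) = Θ (X (i, l)) * Θ (X (k, j)))
    (h2 : ∀ i j, c i = c j → Θ (X (i, j)) = Θ (X (j, i)))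
    (f : MvPolynomial (ι × ι) R)
    (hf : aeval (fun e : ι × ι => (X (.inl (.inl (c e.1))) * X (.inl (.inr (c e.2))) *
      X (.inr e.1) * X (.inr e.2) : MvPolynomial ((κ ⊕ κ) ⊕ ι) R)) f = 0) : Θ f = 0 := by
  classical
  let u : ι × ι → ((κ ⊕ κ) ⊕ ι) →₀ ℕ := fun e =>
    Finsupp.single (.inl (.inl (c e.1))) 1 + Finsupp.single (.inl (.inr (c e.2))) 1 +
      Finsupp.single (.inr e.1) 1 + Finsupp.single (.inr e.2) 1
  have hu : ∀ w : ι × ι →₀ ℕ, Finsupp.toMultiset (w.sum fun s k => k • u s) =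
      (((Finsupp.toMultiset w).map fun e : ι × ι => c e.1).map Sum.inl +
        ((Finsupp.toMultiset w).map fun e : ι × ι => c e.2).map Sum.inr).map Sum.inl +
      ((Finsupp.toMultiset w).map Prod.fst + (Finsupp.toMultiset w).map Prod.snd).map Sum.inr := by
    intro w
    induction w using Finsupp.induction_linear with
    | zero => simp
    | add v w hv hw =>
      rw [Finsupp.sum_add_index' (by simp) (by intros; rw [add_smul])]
      simp only [map_add, hv, hw, Multiset.map_add]
      abel
    | single e k =>
      rw [Finsupp.sum_single_index (by simp)]
      simp [u, Finsupp.toMultiset_single, Multiset.map_nsmul, smul_add]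
      abel
  have hΘ : ∀ w : ι × ι →₀ ℕ,
      Θ (monomial w 1) = ((Finsupp.toMultiset w).map fun e => Θ (X (e.1, e.2))).prod := by
    intro w
    induction w using Finsupp.induction_linear with
    | zero => simp
    | add v w hv hw =>
      rw [map_add, Multiset.map_add, Multiset.prod_add, ← hv, ← hw, ← map_mul, monomial_mul,
        mul_one]
    | single e k =>
      rw [← X_pow_eq_monomial, map_pow]
      simp [Finsupp.toMultiset_single, Multiset.map_nsmul, Multiset.prod_nsmul]
  refine map_eq_zero_of_monomial_map u Θ ?_ f ?_
  · intro w w' h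
    have h' := congrArg Finsupp.toMultiset h
    rw [hu, hu] at h'
    obtain ⟨e1, e2⟩ := eq_of_map_inl_add_map_inr h'
    obtain ⟨e3, e4⟩ := eq_of_map_inl_add_map_inr e1
    rw [hΘ, hΘ]
    exact prod_eq_of_margins (μ := fun i j => Θ (X (i, j))) h1 h2 _ _ e3 e4 e2
  · rw [← hf]
    congr 2
    ext1 e
    simp only [u, X]
    simp only [monomial_mul, mul_one]

end SparseSymmetric

/-! ### Ideals of minors, and connectivity from primality -/

namespace SparseSymmetric

open MvPolynomial

/-- Every `k`-minor, with rows and columns in any order, lies in the ideal of `k`-minors. -/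
theorem det_submatrix_mem_minorIdeal {R : Type*} [CommRing R] {n k : ℕ}
    (A : Matrix (Fin n) (Fin n) R) (r c : Fin k → Fin n) :
    (A.submatrix r c).det ∈ minorIdeal k A := by
  by_cases hr : Function.Injective r
  swap
  · simp only [Function.Injective, not_forall] at hr
    obtain ⟨i, j, hij, hne⟩ := hr
    rw [Matrix.det_zero_of_row_eq hne (by ext; simp [hij])]
    exact zero_mem _
  by_cases hc : Function.Injective c
  swap
  · simp only [Function.Injective, not_forall] at hc
    obtain ⟨i, j, hij, hne⟩ := hc
    rw [Matrix.det_zero_of_column_eq hne (by intro a; simp [hij])]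
    exact zero_mem _
  let r' : Fin k ↪o Fin n := OrderEmbedding.ofStrictMono _
    ((Tuple.monotone_sort r).strictMono_of_injective (hr.comp (Tuple.sort r).injective))
  let c' : Fin k ↪o Fin n := OrderEmbedding.ofStrictMono _
    ((Tuple.monotone_sort c).strictMono_of_injective (hc.comp (Tuple.sort c).injective))
  have h : A.submatrix r c = ((A.submatrix r' c').submatrix ((Tuple.sort r)⁻¹ : Equiv.Perm (Fin k)) id).submatrix id
      ((Tuple.sort c)⁻¹ : Equiv.Perm (Fin k)) := by
    ext i j
    simp [r', c']
  rw [h, Matrix.det_permute', Matrix.det_permute]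
  exact Ideal.mul_mem_left _ _ (Ideal.mul_mem_left _ _ (Ideal.subset_span ⟨r', c', rfl⟩))

theorem minorIdeal_le_ker {R S : Type*} [CommRing R] [CommRing S] {n k : ℕ}
    (A : Matrix (Fin n) (Fin n) R) (φ : R →+* S)
    (h : ∀ r c : Fin k ↪o Fin n, ((A.map φ).submatrix r c).det = 0) :
    minorIdeal k A ≤ RingHom.ker φ := by
  refine Ideal.span_le.2 ?_
  rintro _ ⟨r, c, rfl⟩
  rw [SetLike.mem_coe, RingHom.mem_ker, RingHom.map_det]
  exact h r c

theorem minorIdeal_self {R : Type*} [CommRing R] {n : ℕ} (A : Matrix (Fin n) (Fin n) R) :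
    minorIdeal n A = Ideal.span {A.det} := by
  have h : ∀ r : Fin n ↪o Fin n, (r : Fin n → Fin n) = id := fun r =>
    (r.strictMono.range_inj strictMono_id).1 <| by
      rw [(Finite.surjective_of_injective r.injective).range_eq, Set.range_id]
  refine le_antisymm (Ideal.span_mono ?_) (Ideal.span_mono ?_)
  · rintro _ ⟨r, c, rfl⟩
    rw [h r, h c, Matrix.submatrix_id_id]
    exact Set.mem_singleton _
  · rintro _ rfl
    exact ⟨RelEmbedding.refl _, RelEmbedding.refl _, rfl⟩

section Disconnected

variable {K : Type*} [Field K] {n : ℕ} {G : SimpleGraph (Fin n)}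

-- Specialize to the diagonal matrix with ones at the positions `e i` with `q i`. As `i₀` is
-- excluded, fewer than `k` rows survive and all `k`-minors vanish, while the block becomes the
-- identity.
open Classical in
theorem det_block_notMem_minorIdeal {k : ℕ} (e : Fin k ↪o Fin n) (q : Fin k → Prop) (i₀ : Fin k)
    (hi₀ : ¬ q i₀) :
    (((sparseSymm K G).submatrix e e).toSquareBlockProp q).det ∉
      minorIdeal k (sparseSymm K G) := by
  let ev : PolyRing K n →+* K :=
    (aeval fun s => if ∃ i, q i ∧ s = s(e i, e i) then (1 : K) else 0).toRingHom
  have hev : ∀ i j, ev (sparseSymm K G i j) = if i = j ∧ ∃ a, q a ∧ i = e a then 1 else 0 := by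
    intro i j
    by_cases hij : i = j
    · subst hij
      simp [ev, sparseSymm, genericSymm]
    · by_cases hadj : G.Adj i j
      · have : ¬ ∃ a, q a ∧ (s(i, j) = s(e a, e a)) := by
          rintro ⟨a, -, h⟩
          rw [Sym2.eq_iff] at h
          rcases h with ⟨rfl, rfl⟩ | ⟨rfl, rfl⟩ <;> exact hij rfl
        simp only [sparseSymm, genericSymm, Matrix.of_apply, hij, hadj, or_true, if_true,
          false_and, if_false, ev]
        simp only [AlgHom.toRingHom_eq_coe, RingHom.coe_coe, aeval_X, if_neg this]
      · simp [sparseSymm, hij, hadj]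
  intro hmem
  have h0 : minorIdeal k (sparseSymm K G) ≤ RingHom.ker ev := by
    refine minorIdeal_le_ker _ _ fun r c => ?_
    obtain ⟨a, ha⟩ : ∃ a, ¬ ∃ i, q i ∧ r a = e i := by
      by_contra! h
      choose g hg using h
      have hinj : Function.Injective g := fun a b hab =>
        r.injective (by rw [(hg a).2, (hg b).2, hab])
      obtain ⟨a, rfl⟩ := Finite.surjective_of_injective hinj i₀
      exact hi₀ (hg a).1
    refine Matrix.det_eq_zero_of_row_eq_zero a fun j => ?_
    simp only [Matrix.submatrix_apply, Matrix.map_apply, hev]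
    exact if_neg fun h => ha h.2
  have h1 := h0 hmem
  rw [RingHom.mem_ker, RingHom.map_det] at h1
  have h2 : ev.mapMatrix (((sparseSymm K G).submatrix e e).toSquareBlockProp q) = 1 := by
    ext i j
    simp only [RingHom.mapMatrix_apply, Matrix.map_apply, Matrix.toSquareBlockProp_def,
      Matrix.of_apply, Matrix.submatrix_apply, hev, Matrix.one_apply]
    refine if_congr ?_ rfl rfl
    constructor
    · rintro ⟨h, -⟩
      exact Subtype.ext (e.injective h)
    · rintro rfl
      exact ⟨rfl, _, i.2, rfl⟩
  rw [h2, Matrix.det_one] at h1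
  exact one_ne_zero h1

/-- The component of `u` and its complement split the principal minor into two blocks; `v` and `u`
respectively witness that each block is proper. -/
theorem connected_comap_of_isPrime {k : ℕ} (hk : 0 < k) (e : Fin k ↪o Fin n)
    (hp : (minorIdeal k (sparseSymm K G)).IsPrime) : (G.comap e).Connected := by
  classical
  have : Nonempty (Fin k) := ⟨⟨0, hk⟩⟩
  refine SimpleGraph.connected_iff _ |>.2 ⟨fun u v => ?_, this⟩
  by_contra huv
  have hdet := Matrix.twoBlockTriangular_det ((sparseSymm K G).submatrix e e)
    (fun i => (G.comap e).Reachable u i) (by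
      intro i hi j hj
      have hij : i ≠ j := by rintro rfl; exact hi hj
      have hadj : ¬ G.Adj (e i) (e j) := fun h =>
        hi (hj.trans (SimpleGraph.Adj.reachable (G := G.comap e) (show G.Adj _ _ from h.symm)))
      simp [sparseSymm, hij, hadj])
  have hmem := det_submatrix_mem_minorIdeal (sparseSymm K G) e e
  rw [hdet] at hmem
  rcases hp.mem_or_mem hmem with h | h
  · exact det_block_notMem_minorIdeal e _ v huv (by convert h)
  · exact det_block_notMem_minorIdeal e _ u (not_not_intro (SimpleGraph.Reachable.refl u))
      (by convert h)

theorem isVertexConnected_of_isPrime {k : ℕ} (hk : 0 < k) (hkn : k ≤ n)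
    (hp : (minorIdeal k (sparseSymm K G)).IsPrime) : IsVertexConnected (n - k + 1) G := by
  intro M hM
  have hM' : M.card = k := by omega
  have h := connected_comap_of_isPrime hk (M.orderEmbOfFin hM') hp
  let φ : G.comap (M.orderEmbOfFin hM') ≃g G.induce (M : Set (Fin n)) :=
    { toEquiv := (M.orderIsoOfFin hM').toEquiv
      map_rel_iff' := by
        intro a b
        rfl }
  exact φ.connected_iff.1 h

end Disconnected

end SparseSymmetric

/-! ### Irreducibility of the determinant for connected graphs -/

namespace SparseSymmetric

open MvPolynomial

section Irreducible

variable {K : Type*} [Field K] {n : ℕ} {G : SimpleGraph (Fin n)}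

variable (K G) in
/-- The matrix which agrees with `X_G` on the rows and columns in `U` and with the identity
elsewhere. -/
noncomputable def restrictedMatrix (U : Finset (Fin n)) :
    Matrix (Fin n) (Fin n) (PolyRing K n) :=
  Matrix.of fun i j => if i ∈ U ∧ j ∈ U then sparseSymm K G i j else if i = j then 1 else 0

theorem sparseSymm_self (i : Fin n) : sparseSymm K G i i = X s(i, i) := by
  simp [sparseSymm, genericSymm]

theorem sparseSymm_of_adj {i j : Fin n} (h : G.Adj i j) : sparseSymm K G i j = X s(i, j) := by
  simp [sparseSymm, genericSymm, h]

theorem sparseSymm_of_not_adj {i j : Fin n} (hne : i ≠ j) (h : ¬ G.Adj i j) :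
    sparseSymm K G i j = 0 := by
  simp [sparseSymm, h, hne]

theorem notMem_vars_det (A : Matrix (Fin n) (Fin n) (PolyRing K n)) (e : Sym2 (Fin n))
    (h : ∀ i j, A i j ∈ supported K {e}ᶜ) : e ∉ A.det.vars := by
  have : A.det ∈ supported K {e}ᶜ := by
    rw [Matrix.det_apply]
    refine sum_mem fun σ _ => ?_
    rw [Units.smul_def]
    exact zsmul_mem (prod_mem fun i _ => h _ _) _
  intro he
  exact mem_supported.1 this he rfl

theorem sparseSymm_mem_supported {v i j : Fin n} (h : ¬ (i = v ∧ j = v)) :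
    sparseSymm K G i j ∈ supported K {s(v, v)}ᶜ := by
  by_cases hij : i = j ∨ G.Adj i j
  · have : s(i, j) ∈ ({s(v, v)} : Set (Sym2 (Fin n)))ᶜ := by
      simpa [Sym2.eq_iff] using h
    rw [show sparseSymm K G i j = X s(i, j) by simp [sparseSymm, genericSymm, hij]]
    exact X_mem_supported.2 this
  · rw [show sparseSymm K G i j = 0 by simp [sparseSymm, hij]]
    exact zero_mem _

theorem irreducible_det_insert {U : Finset (Fin n)} {u v : Fin n} (hu : u ∈ U) (hv : v ∉ U)
    (huv : G.Adj u v) (hU : Irreducible (restrictedMatrix K G U).det) :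
    Irreducible (restrictedMatrix K G (insert v U)).det := by
  classical
  have hne : u ≠ v := huv.ne
  set Y := restrictedMatrix K G U with hY
  set Y' := restrictedMatrix K G (insert v U) with hY'
  -- `Z` is `Y'` with `x_vv` set to 0, so `Z.det` is the constant term of `Y'.det` in `x_vv`.
  let Z := Y'.updateRow v (fun j => if j = v then 0 else Y' v j)
  have hYv : ∀ j, Y v j = if v = j then 1 else 0 := by
    intro j
    simp [hY, restrictedMatrix, hv]
  have hYv' : ∀ i, Y i v = if i = v then 1 else 0 := by
    intro j
    simp [hY, restrictedMatrix, hv]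
  have hYY' : ∀ i j, i ≠ v → j ≠ v → Y' i j = Y i j := by
    intro i j hi hj
    simp [hY, hY', restrictedMatrix, hi, hj]
  have hZ : ∀ i j, ¬ (i = v ∧ j = v) → Z i j = Y' i j := by
    intro i j h
    by_cases hi : i = v
    · subst hi
      have : j ≠ i := fun h' => h ⟨rfl, h'⟩
      simp [Z, this]
    · simp [Z, Matrix.updateRow_ne hi]
  have hZv : Z v v = 0 := by simp [Z]
  have hY'v : Y' v v = X s(v, v) := by
    simp [hY', restrictedMatrix, sparseSymm_self]
  have hdet : Y'.det = Y.det * X s(v, v) + Z.det := by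
    have h1 : Y' = Z.updateRow v (Z v + (X s(v, v) : PolyRing K n) • Pi.single v 1) := by
      ext1 i j
      by_cases hi : i = v
      · subst hi
        rw [Matrix.updateRow_self]
        by_cases hj : j = i
        · subst hj
          simp [hZv, hY'v]
        · rw [Pi.add_apply, hZ _ _ (fun h => hj h.2)]
          simp [hj]
      · rw [Matrix.updateRow_ne hi, hZ _ _ (fun h => hi h.1)]
    have h2 : (Z.updateRow v (Pi.single v 1)).det = Y.det := by
      refine Matrix.det_eq_of_forall_row_eq_smul_add_const
        (fun i => if i = v then 0 else Z i v) v (by simp) fun i j => ?_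
      rw [hYv]
      by_cases hi : i = v
      · subst hi
        simp [hYv, Pi.single_apply, eq_comm]
      · rw [Matrix.updateRow_ne hi, if_neg hi, hZ _ _ (fun h => hi h.1),
          hZ _ _ (fun h => hi h.1)]
        by_cases hj : j = v
        · subst hj
          simp [hYv', hi]
        · simp [hYY' i j hi hj, Ne.symm hj]
    rw [h1, Matrix.det_updateRow_add, Matrix.det_updateRow_smul, Matrix.updateRow_eq_self, h2]
    ring
  have hYsupp : ∀ i j, Y i j ∈ supported K {s(v, v)}ᶜ := by
    intro i j
    simp only [hY, restrictedMatrix, Matrix.of_apply]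
    split_ifs with h1 h2
    · exact sparseSymm_mem_supported fun h => hv (h.1 ▸ h1.1)
    · exact one_mem _
    · exact zero_mem _
  have hZsupp : ∀ i j, Z i j ∈ supported K {s(v, v)}ᶜ := by
    intro i j
    by_cases h : i = v ∧ j = v
    · rw [h.1, h.2, hZv]; exact zero_mem _
    rw [hZ i j h]
    simp only [hY', restrictedMatrix, Matrix.of_apply]
    split_ifs with h1 h2
    · exact sparseSymm_mem_supported h
    · exact one_mem _
    · exact zero_mem _
  rw [hdet]
  refine irreducible_mul_X_add _ _ _ hU.ne_zero (notMem_vars_det _ _ hYsupp)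
    (notMem_vars_det _ _ hZsupp) (hU.isRelPrime_iff_not_dvd.2 fun hdvd => ?_)
  -- At this point the enlarged matrix is the permutation matrix of the transposition of `u` and
  -- `v`, with determinant -1, whereas row `u` of `Y` is zero because its only nonzero entry would
  -- be in column `v`.
  let ev : PolyRing K n →+* K := (aeval fun s => if s = s(u, v) then (1 : K) else
    if ∃ w, w ≠ u ∧ w ≠ v ∧ s = s(w, w) then 1 else 0).toRingHom
  have hevX : ∀ i j, ev (X s(i, j)) = if s(i, j) = s(u, v) then (1 : K) else
    if ∃ w, w ≠ u ∧ w ≠ v ∧ s(i, j) = s(w, w) then 1 else 0 := by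
    intro i j
    simp only [ev, AlgHom.toRingHom_eq_coe, RingHom.coe_coe, aeval_X]
  have hevd : ∀ i, ev (X s(i, i)) = if i = u ∨ i = v then (0 : K) else 1 := by
    intro i
    rw [hevX, if_neg]
    · by_cases h : i = u ∨ i = v
      · rw [if_neg, if_pos h]
        rintro ⟨w, h1, h2, h3⟩
        have : i = w := by simpa using h3
        subst this
        exact h.elim h1 h2
      · rw [if_pos, if_neg h]
        push Not at h
        exact ⟨i, h.1, h.2, rfl⟩
    · intro h
      rw [Sym2.eq_iff] at h
      rcases h with ⟨h1, h2⟩ | ⟨h1, h2⟩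
      · exact hne (h1.symm.trans h2)
      · exact hne (h2.symm.trans h1)
  have hevo : ∀ i j, i ≠ j → ev (sparseSymm K G i j) =
      if (i = u ∧ j = v) ∨ (i = v ∧ j = u) then 1 else 0 := by
    intro i j hij
    by_cases hadj : G.Adj i j
    · rw [sparseSymm_of_adj hadj, hevX]
      have : ¬ ∃ w, w ≠ u ∧ w ≠ v ∧ s(i, j) = s(w, w) := by
        rintro ⟨w, -, -, h⟩
        rw [Sym2.eq_iff] at h
        rcases h with ⟨rfl, rfl⟩ | ⟨rfl, rfl⟩ <;> exact hij rfl
      rw [if_neg this]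
      refine if_congr ?_ rfl rfl
      rw [Sym2.eq_iff]
    · rw [sparseSymm_of_not_adj hij hadj, map_zero, if_neg]
      rintro (⟨rfl, rfl⟩ | ⟨rfl, rfl⟩)
      exacts [hadj huv, hadj huv.symm]
  have hD : ev Y.det = 0 := by
    rw [RingHom.map_det]
    refine Matrix.det_eq_zero_of_row_eq_zero u fun j => ?_
    simp only [RingHom.mapMatrix_apply, Matrix.map_apply, hY, restrictedMatrix, Matrix.of_apply]
    split_ifs with h1 h2
    · by_cases hj : u = j
      · subst hj
        rw [sparseSymm_self, hevd]; simp
      · rw [hevo _ _ hj, if_neg]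
        rintro (⟨-, rfl⟩ | ⟨rfl, -⟩)
        exacts [hv h1.2, hne rfl]
    · exact absurd ⟨hu, h2 ▸ hu⟩ h1
    · simp
  have hN : ev Z.det = -1 := by
    have : ev.mapMatrix Z = (Equiv.swap u v).permMatrix K := by
      ext i j
      simp only [RingHom.mapMatrix_apply, Matrix.map_apply, Equiv.Perm.permMatrix,
        PEquiv.toMatrix_apply, Equiv.toPEquiv_apply, Option.mem_def, Option.some.injEq]
      by_cases hv2 : i = v ∧ j = v
      · rw [hv2.1, hv2.2, hZv, map_zero, Equiv.swap_apply_right, if_neg hne]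
      rw [hZ i j hv2]
      simp only [hY', restrictedMatrix, Matrix.of_apply]
      have hu' : u ∈ insert v U := Finset.mem_insert_of_mem hu
      have hv' : v ∈ insert v U := Finset.mem_insert_self v U
      by_cases hij : i = j
      · subst hij
        have hiv : i ≠ v := fun h => hv2 ⟨h, h⟩
        by_cases hiu : i = u
        · subst hiu
          rw [if_pos ⟨hu', hu'⟩, sparseSymm_self, hevd, Equiv.swap_apply_left]
          simp [hne.symm]
        · rw [Equiv.swap_apply_of_ne_of_ne hiu hiv]
          by_cases h : i ∈ insert v U
          · rw [if_pos ⟨h, h⟩, sparseSymm_self, hevd, if_neg (not_or.2 ⟨hiu, hiv⟩), if_pos rfl]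
          · rw [if_neg fun h' => h h'.1, if_pos rfl, map_one, if_pos rfl]
      · have e1 : ev (if i ∈ insert v U ∧ j ∈ insert v U then sparseSymm K G i j
            else if i = j then 1 else 0) =
            if (i = u ∧ j = v) ∨ (i = v ∧ j = u) then 1 else 0 := by
          by_cases h : i ∈ insert v U ∧ j ∈ insert v U
          · rw [if_pos h, hevo _ _ hij]
          · rw [if_neg h, if_neg hij, map_zero, if_neg]
            rintro (⟨rfl, rfl⟩ | ⟨rfl, rfl⟩)
            exacts [h ⟨hu', hv'⟩, h ⟨hv', hu'⟩]
        rw [e1]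
        refine if_congr ?_ rfl rfl
        constructor
        · rintro (⟨rfl, rfl⟩ | ⟨rfl, rfl⟩)
          · exact Equiv.swap_apply_left _ _
          · exact Equiv.swap_apply_right _ _
        · intro h
          by_cases hiu : i = u
          · subst hiu
            rw [Equiv.swap_apply_left] at h
            exact Or.inl ⟨rfl, h.symm⟩
          by_cases hiv : i = v
          · subst hiv
            rw [Equiv.swap_apply_right] at h
            exact Or.inr ⟨rfl, h.symm⟩
          rw [Equiv.swap_apply_of_ne_of_ne hiu hiv] at h
          exact absurd h hij
    rw [RingHom.map_det, this, Matrix.det_permutation, Equiv.Perm.sign_swap hne]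
    simp
  have := map_dvd ev hdvd
  rw [hD, hN, zero_dvd_iff] at this
  exact one_ne_zero (neg_eq_zero.1 this)

theorem irreducible_det_of_connected (hG : G.Connected) :
    Irreducible (sparseSymm K G).det := by
  classical
  obtain ⟨v₀⟩ := hG.nonempty
  have h0 : Irreducible (restrictedMatrix K G {v₀}).det := by
    have : restrictedMatrix K G {v₀} = Matrix.diagonal fun i => if i = v₀ then X s(v₀, v₀) else 1 := by
      ext1 i j
      by_cases hij : i = j
      · subst hij
        by_cases hi : i = v₀
        · subst hi
          simp [restrictedMatrix, sparseSymm_self]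
        · simp [restrictedMatrix, hi]
      · rw [Matrix.diagonal_apply_ne _ hij]
        have : ¬ (i = v₀ ∧ j = v₀) := fun h => hij (h.1.trans h.2.symm)
        simp [restrictedMatrix, hij, this]
    rw [this, Matrix.det_diagonal, Finset.prod_ite_eq' Finset.univ v₀]
    simpa using (MvPolynomial.X_prime (i := s(v₀, v₀)) (R := K)).irreducible
  obtain ⟨U, hU, hmax⟩ := Finset.exists_max_image
    (Finset.univ.filter fun U : Finset (Fin n) => U.Nonempty ∧
      Irreducible (restrictedMatrix K G U).det) Finset.card
    ⟨{v₀}, by simp [h0]⟩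
  rw [Finset.mem_filter] at hU
  obtain ⟨-, ⟨u₀, hu₀⟩, hirr⟩ := hU
  have huniv : U = Finset.univ := by
    by_contra hne
    obtain ⟨w, hw⟩ : ∃ w, w ∉ U := by
      by_contra! h
      exact hne (Finset.eq_univ_iff_forall.2 h)
    obtain ⟨p⟩ := hG.preconnected u₀ w
    -- A path leaving `U` crosses an edge along which `U` can be enlarged, contradicting maximality.
    obtain ⟨d, -, hd1, hd2⟩ := p.exists_boundary_dart (U : Set (Fin n)) hu₀ hw
    have h1 := irreducible_det_insert (K := K) hd1 hd2 d.adj hirr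
    have h2 := hmax (insert d.snd U) (by simp [h1])
    rw [Finset.card_insert_of_notMem hd2] at h2
    omega
  have : restrictedMatrix K G U = sparseSymm K G := by
    ext1 i j
    simp [restrictedMatrix, huniv]
  rwa [this] at hirr

theorem connected_iff_isPrime_minorIdeal_self (hn : 0 < n) :
    (minorIdeal n (sparseSymm K G)).IsPrime ↔ G.Connected := by
  constructor
  · intro h
    exact connected_comap_of_isPrime hn (RelEmbedding.refl _) h
  · intro h
    have hirr := irreducible_det_of_connected (K := K) h
    rw [minorIdeal_self, Ideal.span_singleton_prime hirr.ne_zero]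
    exact hirr.prime

end Irreducible

end SparseSymmetric

/-! ### Primality of the ideals of 2-minors and 3-minors -/

namespace SparseSymmetric

open MvPolynomial

section SmallMinors

variable {K : Type*} [Field K] {n : ℕ} {G : SimpleGraph (Fin n)}

theorem not_induce_connected_of_isolated {V : Type*} {G : SimpleGraph V} {M : Set V} {i j : V}
    (hi : i ∈ M) (hj : j ∈ M) (hij : i ≠ j) (h : ∀ w ∈ M, ¬ G.Adj i w) :
    ¬ (G.induce M).Connected := by
  intro hc
  obtain ⟨p⟩ := hc.preconnected ⟨i, hi⟩ ⟨j, hj⟩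
  cases p with
  | nil => exact hij rfl
  | cons hadj _ => exact h _ (Subtype.prop _) hadj

/-- The ideal of `2`-minors is prime if `G` is complete. -/
theorem isPrime_minorIdeal_two (hG : ∀ i j, i ≠ j → G.Adj i j) :
    (minorIdeal 2 (sparseSymm K G)).IsPrime := by
  have hX : ∀ i j, sparseSymm K G i j = X s(i, j) := by
    intro i j
    by_cases hij : i = j
    · rw [hij, sparseSymm_self]
    · exact sparseSymm_of_adj (hG i j hij)
  let γ : MvPolynomial (Fin n × Fin n) K →ₐ[K] MvPolynomial ((Unit ⊕ Unit) ⊕ Fin n) K :=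
    aeval fun e : Fin n × Fin n => X (.inl (.inl ())) * X (.inl (.inr ())) *
      X (.inr e.1) * X (.inr e.2)
  have hγ : ∀ i j, γ (X (i, j)) = X (.inl (.inl ())) * X (.inl (.inr ())) *
      X (.inr i) * X (.inr j) := fun i j => aeval_X _ _
  -- The chosen order of each pair is immaterial, as both `γ` and `θ` are symmetric on variables.
  let lift : PolyRing K n →ₐ[K] MvPolynomial (Fin n × Fin n) K := aeval fun s => X s.out
  let q := Ideal.Quotient.mkₐ K (minorIdeal 2 (sparseSymm K G))
  let θ : MvPolynomial (Fin n × Fin n) K →ₐ[K] PolyRing K n ⧸ minorIdeal 2 (sparseSymm K G) :=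
    aeval fun e => q (X s(e.1, e.2))
  have hθ : ∀ i j, θ (X (i, j)) = q (X s(i, j)) := fun i j => aeval_X _ _
  have hlift : θ.comp lift = q := by
    ext s
    simp only [AlgHom.comp_apply, lift, aeval_X]
    rw [show s.out = (s.out.1, s.out.2) from rfl, hθ]
    congr 2
    exact s.out_eq
  have hγX : ∀ i j, γ (lift (X s(i, j))) = γ (X (i, j)) := by
    intro i j
    simp only [lift, aeval_X]
    have h : s((s(i, j)).out.1, (s(i, j)).out.2) = s(i, j) := (s(i, j)).out_eq
    rw [show (s(i, j)).out = ((s(i, j)).out.1, (s(i, j)).out.2) from rfl, hγ, hγ]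
    rcases Sym2.eq_iff.1 h with ⟨h1, h2⟩ | ⟨h1, h2⟩
    · rw [h1, h2]
    · rw [h1, h2]; ring
  suffices h : minorIdeal 2 (sparseSymm K G) = RingHom.ker (γ.comp lift).toRingHom by
    rw [h]; exact RingHom.ker_isPrime _
  refine le_antisymm ?_ fun f hf => ?_
  · refine minorIdeal_le_ker _ _ fun r c => ?_
    simp only [Matrix.det_fin_two, Matrix.submatrix_apply, Matrix.map_apply, hX,
      AlgHom.toRingHom_eq_coe, RingHom.coe_coe, AlgHom.comp_apply, hγX, hγ]
    ring
  · have h1 := map_eq_zero_of_margin_map (fun _ : Fin n => ()) θ.toRingHom (by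
      intro i j k l
      simp only [AlgHom.toRingHom_eq_coe, RingHom.coe_coe, hθ]
      rw [← map_mul, ← map_mul, ← sub_eq_zero, ← map_sub]
      refine Ideal.Quotient.eq_zero_iff_mem.2 ?_
      have := det_submatrix_mem_minorIdeal (sparseSymm K G) ![i, k] ![j, l]
      rw [Matrix.det_fin_two] at this
      simpa [hX] using this) (by
      intro i j _
      simp only [AlgHom.toRingHom_eq_coe, RingHom.coe_coe, hθ, Sym2.eq_swap]) (lift f) hf
    have h2 : q f = 0 := by rw [← hlift]; exact h1
    exact Ideal.Quotient.eq_zero_iff_mem.1 h2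

/-- The ideal of `3`-minors is prime if the non-edges of `G` form a matching. -/
theorem isPrime_minorIdeal_three [CharZero K]
    (hG : ∀ i j k, i ≠ j → j ≠ k → i ≠ k → ¬ G.Adj i j → ¬ G.Adj j k → False) :
    (minorIdeal 3 (sparseSymm K G)).IsPrime := by
  classical
  let S := PolyRing K n
  -- This set contains `i` itself. As the non-edges form a matching, "equal or non-adjacent" is an
  -- equivalence relation with classes `c i` of size one or two.
  let c : Fin n → Set (Fin n) := fun i => {j | ¬ G.Adj i j}
  have hc : ∀ i j, c i = c j ↔ ¬ G.Adj i j := by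
    intro i j
    constructor
    · intro h
      have : j ∈ c j := G.irrefl
      rw [← h] at this
      exact this
    · intro h
      by_cases hij : i = j
      · rw [hij]
      ext k
      simp only [c, Set.mem_ofPred_eq]
      constructor
      · intro hk hjk
        have hik : i ≠ k := by rintro rfl; exact h hjk.symm
        exact hG k i j hik.symm hij hjk.ne.symm (fun h => hk h.symm) h
      · intro hk hik
        have hjk : j ≠ k := by rintro rfl; exact h hik
        exact hG i j k hij hjk hik.ne h hk
  -- Opposite signs at the two ends of a non-edge turn the antisymmetry of `μ` there into the
  -- symmetry that the margin argument needs.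
  let ε : Fin n → S := fun i => if ∃ j < i, ¬ G.Adj i j then -1 else 1
  have hε : ∀ i, ε i * ε i = 1 := by
    intro i
    by_cases h : ∃ j < i, ¬ G.Adj i j
    · simp only [ε, if_pos h]; ring
    · simp only [ε, if_neg h]; ring
  have hε' : ∀ i j, i ≠ j → ¬ G.Adj i j → ε i + ε j = 0 := by
    have key : ∀ i j, i < j → ¬ G.Adj i j → ε i + ε j = 0 := by
      intro i j hij h
      have h1 : ∃ k < j, ¬ G.Adj j k := ⟨i, hij, fun h' => h h'.symm⟩
      have h2 : ¬ ∃ k < i, ¬ G.Adj i k := by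
        rintro ⟨k, hk, hik⟩
        exact hG k i j hk.ne hij.ne (hk.trans hij).ne (fun h => hik h.symm) h
      simp [ε, h1, h2]
    intro i j hne h
    rcases lt_or_gt_of_ne hne with h' | h'
    · exact key i j h' h
    · rw [add_comm]; exact key j i h' fun h' => h h'.symm
  let D := MvPolynomial ((Set (Fin n) ⊕ Set (Fin n)) ⊕ Fin n) S
  let γ : MvPolynomial (Fin n × Fin n) S →ₐ[S] D :=
    aeval fun e : Fin n × Fin n => X (.inl (.inl (c e.1))) * X (.inl (.inr (c e.2))) *
      X (.inr e.1) * X (.inr e.2)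
  have hγ : ∀ i j, γ (X (i, j)) = X (.inl (.inl (c i))) * X (.inl (.inr (c j))) *
      X (.inr i) * X (.inr j) := fun i j => aeval_X _ _
  -- Non-edge variables do not occur in `X_G` and are carried along as coefficients, which is why
  -- the coefficient ring is `S`.
  let entry : Fin n → Fin n → MvPolynomial (Fin n × Fin n) S := fun i j =>
    if i = j ∨ G.Adj i j then C (ε j) * X (i, j) + C (ε i) * X (j, i) else C (X s(i, j))
  have hentry : ∀ i j, entry i j = entry j i := by
    intro i j
    simp only [entry, eq_comm (a := i), G.adj_comm i, Sym2.eq_swap (a := i)]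
    rw [add_comm]
  let lift : S →ₐ[K] MvPolynomial (Fin n × Fin n) S := aeval (Sym2.lift ⟨entry, hentry⟩)
  have hliftX : ∀ i j, lift (X s(i, j)) = entry i j := fun i j => aeval_X _ _
  let I := minorIdeal 3 (sparseSymm K G)
  let q := Ideal.Quotient.mkₐ K I
  have hφ : ∀ i j, γ (lift (sparseSymm K G i j)) =
      γ (C (ε j) * X (i, j) + C (ε i) * X (j, i)) := by
    intro i j
    by_cases h : i = j ∨ G.Adj i j
    · rw [show sparseSymm K G i j = X s(i, j) by simp [sparseSymm, genericSymm, h], hliftX]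
      simp only [entry, if_pos h]
    · push Not at h
      rw [sparseSymm_of_not_adj h.1 h.2, map_zero, map_zero, map_add, map_mul, map_mul, hγ, hγ,
        (hc i j).2 h.2]
      have h0 : γ (C (ε i)) + γ (C (ε j)) = 0 := by
        rw [← map_add, ← map_add, hε' i j h.1 h.2, map_zero, map_zero]
      linear_combination (-1) * (X (.inl (.inl (c j))) * X (.inl (.inr (c j))) *
        X (.inr i) * X (.inr j)) * h0
  suffices h : I = RingHom.ker (γ.toRingHom.comp lift.toRingHom) by
    change I.IsPrime
    rw [h]; exact RingHom.ker_isPrime _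
  refine le_antisymm ?_ fun f hf => ?_
  -- By `hφ` the image of `X_G` is a rank-one matrix plus its transpose, so its 3-minors vanish.
  · refine minorIdeal_le_ker _ _ fun r s => ?_
    simp only [Matrix.det_fin_three, Matrix.submatrix_apply, Matrix.map_apply,
      AlgHom.toRingHom_eq_coe, RingHom.coe_coe, RingHom.comp_apply, hφ, hγ, map_add, map_mul]
    ring
  · let p : Fin n → Fin n → S ⧸ I := fun i j => q (sparseSymm K G i j)
    have hsymm : ∀ i j, sparseSymm K G i j = sparseSymm K G j i := by
      intro i j
      simp only [sparseSymm, genericSymm, Matrix.of_apply, eq_comm (a := i), G.adj_comm i,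
        Sym2.eq_swap (a := i)]
    obtain ⟨T, _, inc, μ, hinj, hadd, hmul⟩ := exists_ring_of_rank_two
      (algebraMap K (S ⧸ I) (1 / 2)) (by
        rw [← map_ofNat (algebraMap K (S ⧸ I)) 2, ← map_mul]
        simp) p (fun i j => by simp only [p]; rw [hsymm]) (by
        intro i w x j k l
        have := det_submatrix_mem_minorIdeal (sparseSymm K G) ![i, w, x] ![j, k, l]
        have h0 : q ((sparseSymm K G).submatrix ![i, w, x] ![j, k, l]).det = 0 :=
          Ideal.Quotient.eq_zero_iff_mem.2 this
        simp only [Matrix.det_fin_three, Matrix.submatrix_apply, map_add, map_sub, map_mul] at h0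
        simp only [p]
        rw [← h0]
        simp
        ring)
    let ι : S →+* T := inc.comp q.toRingHom
    have hιε : ∀ i, ι (ε i) * ι (ε i) = 1 := fun i => by rw [← map_mul, hε, map_one]
    let θ : MvPolynomial (Fin n × Fin n) S →+* T := eval₂Hom ι fun e => ι (ε e.2) * μ e.1 e.2
    have hθ : ∀ i j, θ (X (i, j)) = ι (ε j) * μ i j := fun i j => eval₂Hom_X' _ _ _
    have hθC : ∀ a, θ (C a) = ι a := fun a => eval₂Hom_C _ _ _
    -- Since each sign squares to 1, `θ` sends the lifted entry back to `μ i j + μ j i`, the class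
    -- of `x_ij` in the quotient. So once `θ` kills `lift f`, injectivity of `inc` gives `f ∈ I`.
    have hlift : θ.comp lift.toRingHom = ι := by
      refine MvPolynomial.ringHom_ext (fun a => ?_) fun s => ?_
      · have : lift (C a) = C (C a) := by
          change lift (algebraMap K S a) = _
          rw [AlgHom.commutes]; rfl
        simp only [AlgHom.toRingHom_eq_coe, RingHom.comp_apply, RingHom.coe_coe, this, hθC]
      · induction s using Sym2.ind with | _ i j => ?_
        simp only [AlgHom.toRingHom_eq_coe, RingHom.comp_apply, RingHom.coe_coe, hliftX, entry]
        split_ifs with h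
        · have h' : sparseSymm K G i j = X s(i, j) := by simp [sparseSymm, genericSymm, h]
          have h2 : ι (X s(i, j)) = μ i j + μ j i := by
            rw [hadd, ← h']; rfl
          rw [map_add, map_mul, map_mul, hθC, hθC, hθ, hθ, h2]
          linear_combination μ i j * hιε j + μ j i * hιε i
        · rw [hθC]
    have h1 := map_eq_zero_of_margin_map c θ (by
      intro i j k l
      rw [hθ, hθ, hθ, hθ]
      linear_combination ι (ε j) * ι (ε l) * hmul i j k l) (by
      intro i j hij
      rw [hθ, hθ]
      by_cases hne : i = j
      · rw [hne]
      have hadj := (hc i j).1 hij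
      have h1 : ι (ε i) + ι (ε j) = 0 := by rw [← map_add, hε' i j hne hadj, map_zero]
      have h2 : μ i j + μ j i = 0 := by
        rw [hadd]
        simp only [p]
        rw [sparseSymm_of_not_adj hne hadj, map_zero, map_zero]
      linear_combination ι (ε j) * h2 - μ j i * h1) (lift f) hf
    have h2 : ι f = 0 := by rw [← hlift]; exact h1
    have h3 : q f = 0 := hinj (by rw [map_zero]; exact h2)
    exact Ideal.Quotient.eq_zero_iff_mem.1 h3

end SmallMinors

end SparseSymmetric

theorem proposition5p2 {K : Type*} [Field K] {n : ℕ} (hn : 2 ≤ n) (G : SimpleGraph (Fin n)) :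
    (SparseSymmetric.minorIdeal n (SparseSymmetric.sparseSymm K G) =
        Ideal.span {(SparseSymmetric.sparseSymm K G).det} ∧
      ((SparseSymmetric.minorIdeal n (SparseSymmetric.sparseSymm K G)).IsPrime ↔ G.Connected) ∧
      (Irreducible (SparseSymmetric.sparseSymm K G).det ↔ G.Connected)) ∧
    (CharZero K → ∀ k : ℕ, k = 2 ∨ k = 3 → k ≤ n →
      ((SparseSymmetric.minorIdeal k (SparseSymmetric.sparseSymm K G)).IsPrime ↔
        SparseSymmetric.IsVertexConnected (n - k + 1) G)) := by
  open SparseSymmetric in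
  have hconn := connected_iff_isPrime_minorIdeal_self (K := K) (G := G) (by omega : 0 < n)
  refine ⟨⟨minorIdeal_self _, hconn, fun h => ?_, irreducible_det_of_connected⟩, ?_⟩
  · rw [← hconn, minorIdeal_self, Ideal.span_singleton_prime h.ne_zero]
    exact h.prime
  · intro _ k hk hkn
    refine ⟨isVertexConnected_of_isPrime (by omega) hkn, fun h => ?_⟩
    rcases hk with rfl | rfl
    · refine isPrime_minorIdeal_two fun i j hij => ?_
      by_contra hadj
      refine not_induce_connected_of_isolated (M := (({i, j} : Finset (Fin n)) : Set (Fin n)))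
        (by simp) (by simp) hij (fun w hw => ?_)
        (h {i, j} (by rw [Finset.card_pair hij]; omega))
      have hw' : w = i ∨ w = j := by simpa using hw
      rcases hw' with rfl | rfl
      exacts [G.irrefl, hadj]
    -- Two non-edges meeting at `j` would isolate `j` inside the triple.
    · refine isPrime_minorIdeal_three fun i j l hij hjl hil h1 h2 => ?_
      refine not_induce_connected_of_isolated (M := (({i, j, l} : Finset (Fin n)) : Set (Fin n)))
        (i := j) (by simp) (by simp) hij.symm (fun w hw => ?_)
        (h {i, j, l} (by rw [Finset.card_eq_three.2 ⟨i, j, l, hij, hil, hjl, rfl⟩]; omega))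
      have hw' : w = i ∨ w = j ∨ w = l := by simpa using hw
      rcases hw' with rfl | rfl | rfl
      exacts [fun h => h1 h.symm, G.irrefl, h2]
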